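/- Let $n\ge 1$ and let $(M^{2n+1},\theta)$ be a (nonempty) strictly pseudoconvex pseudohermitian manifold: $M$ is a smooth manifold with an integrable CR structure $T^{1,0}M$ of CR dimension $n$ and a real contact form $\theta$ with $H=\operatorname{Re}(T^{1,0}M\oplus T^{0,1}M)=\ker\theta$ and $d\theta(X,JX)>0$ for $0\ne X\in H$, where $J$ is the complex structure of $H$. Let $T$ be its Reeb field ($\theta(T)=1$, $d\theta(T,\cdot)=0$). Let $\Box_b=\bar\partial_b^*\bar\partial_b$ be the Kohn Laplacian on functions, that is, $\Box_b f=-h^{\alpha\bar\beta}\nabla_\alpha\nabla_{\bar\beta}f$ with $\nabla$ the Tanaka–Webster connection and $h_{\alpha\bar\beta}=-i\,d\theta(Z_\alpha,Z_{\bar\beta})$ the Levi form. Equip $\mathbb{C}^N$ with $\omega=i\partial\bar\partial\|Z\|^2$, and for $r>0$ equip the sphere $r\cdot\mathbb{S}^{2N-1}=\{\|Z\|=r\}$ with the contact form $\Theta_r$ that is the restriction of $i\bar\partial\|Z\|^2$. A smooth CR immersion $Z\colon M\to\mathbb{C}^N$ is called semi-isometric if $d\theta=Z^*\omega$. A smooth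 CR immersion $F\colon M\to r\cdot\mathbb{S}^{2N-1}$ is called a pseudohermitian immersion if $F^*\Theta_r=\theta$ and $F_*T$ is the Reeb field of $\Theta_r$ along $F$. **Theorem (Takahashi-type theorem).** Let $Z\colon (M,\theta)\to(\mathbb{C}^N,\omega)$ be a semi-isometric CR immersion and suppose that $\Box_b\overline{Z}=\lambda\overline{Z}$ componentwise, for a constant $\lambda\in\mathbb{C}$. Then 1. $\lambda$ is real and $\lambda>0$; 2. $Z(M)\subset r\cdot\mathbb{S}^{2N-1}$, where $r=\sqrt{n/\lambda}$; 3. $Z\colon M\to r\cdot\mathbb{S}^{2N-1}$ is a pseudohermitian immersion. Conversely, if $r>0$ and $F\colon M\to r\cdot\mathbb{S}^{2N-1}$ is a pseudohermitian immersion, then $\Box_b\overline{F}=(n/r^2)\,\overline{F}$ componentwise. -/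

import Mathlib

open scoped Manifold ContDiff Topology ComplexConjugate
open Bundle VectorField

noncomputable section

/-! ## Vector fields, one-forms and complexified vector fields on a manifold -/

section Manifold

variable {m : ℕ} {M : Type*} [TopologicalSpace M] [ChartedSpace (EuclideanSpace ℝ (Fin m)) M]

/-- The derivative `df_p(v)` of a function with values in a real normed space. -/
def dirDeriv {V : Type*} [NormedAddCommGroup V] [NormedSpace ℝ V] (f : M → V) (p : M)
    (v : TangentSpace (𝓡 m) p) : V :=
  mfderiv (𝓡 m) 𝓘(ℝ, V) f p v

variable [IsManifold (𝓡 m) ∞ M]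

/-- A real vector field `X` is smooth at `p`. -/
def SmoothFieldAt (X : ∀ q : M, TangentSpace (𝓡 m) q) (p : M) : Prop :=
  ContMDiffAt (𝓡 m) (𝓡 m).tangent ∞ (fun q => (⟨q, X q⟩ : TangentBundle (𝓡 m) M)) p

/-- The local vector field around `p` with constant coefficients, in the standard trivialization
of the tangent bundle at `p`, and with value `v` at `p`. -/
def extendField {p : M} (v : TangentSpace (𝓡 m) p) (q : M) :
    TangentSpace (𝓡 m) q :=
  FiberBundle.extend (EuclideanSpace ℝ (Fin m)) v q

/-- The function `X(θ(Y)) - Y(θ(X)) - θ([X, Y])` for a one-form `θ` and vector fields `X, Y`. -/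
def extDerivField (θ : ∀ q : M, TangentSpace (𝓡 m) q →L[ℝ] ℝ)
    (X Y : ∀ q : M, TangentSpace (𝓡 m) q) (p : M) : ℝ :=
  dirDeriv (fun q => θ q (Y q)) p (X p) - dirDeriv (fun q => θ q (X q)) p (Y p)
    - θ p (mlieBracket (𝓡 m) X Y p)

/-- The exterior derivative `(dθ)_p(u, v)` of a one-form: for smooth `θ` the expression
`X(θ(Y)) - Y(θ(X)) - θ([X, Y])` at `p` depends only on `u = X_p` and `v = Y_p`; it is evaluated on
local extensions of `u` and `v`. -/
def extDerivOneForm (θ : ∀ q : M, TangentSpace (𝓡 m) q →L[ℝ] ℝ) (p : M)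
    (u v : TangentSpace (𝓡 m) p) : ℝ :=
  extDerivField θ (extendField u) (extendField v) p

variable (m M) in
/-- A complex vector field `re + i im`, i.e. a section of the complexified tangent bundle. -/
structure ComplexField where
  /-- the real part -/
  re : ∀ q : M, TangentSpace (𝓡 m) q
  /-- the imaginary part -/
  im : ∀ q : M, TangentSpace (𝓡 m) q

namespace ComplexField

/-- Both real components are smooth at `p`. -/
def SmoothAt (Z : ComplexField m M) (p : M) : Prop :=
  SmoothFieldAt Z.re p ∧ SmoothFieldAt Z.im p

/-- The complex bilinear extension of the Lie bracket:
`[A + iB, C + iD] = [A, C] - [B, D] + i ([A, D] + [B, C])`. -/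
def bracket (Z W : ComplexField m M) : ComplexField m M where
  re q := mlieBracket (𝓡 m) Z.re W.re q - mlieBracket (𝓡 m) Z.im W.im q
  im q := mlieBracket (𝓡 m) Z.re W.im q + mlieBracket (𝓡 m) Z.im W.re q

/-- The derivative `Z f = A f + i (B f)` of a complex-valued function along `Z = A + iB`. -/
def apply (Z : ComplexField m M) (f : M → ℂ) (q : M) : ℂ :=
  dirDeriv f q (Z.re q) + Complex.I * dirDeriv f q (Z.im q)

end ComplexField

end Manifold

/-! ## Pseudohermitian manifolds and the Kohn Laplacian -/

/-- A strictly pseudoconvex pseudohermitian structure `(H, J, θ)` on a manifold `M` of dimension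
`2n + 1`. The bundle `H = ker θ` is the real part of `T^{1,0} ⊕ T^{0,1}`, `J` is its complex
structure, and `T^{1,0} = {X - i J X : X ∈ H}`. The endomorphism `J` of `H` is extended to `TM` by
`J T = 0` on the Reeb field `T`; the field `T` is determined by `theta_reeb` and `dtheta_reeb`. -/
structure Pseudohermitian (n : ℕ) (M : Type*) [TopologicalSpace M]
    [ChartedSpace (EuclideanSpace ℝ (Fin (2 * n + 1))) M]
    [IsManifold (𝓡 (2 * n + 1)) ∞ M] where
  /-- the contact form -/
  theta : ∀ p : M, TangentSpace (𝓡 (2 * n + 1)) p →L[ℝ] ℝ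
  /-- the complex structure of `ker θ`, extended by zero on the Reeb field -/
  J : ∀ p : M, TangentSpace (𝓡 (2 * n + 1)) p →L[ℝ] TangentSpace (𝓡 (2 * n + 1)) p
  /-- the Reeb field -/
  reeb : ∀ p : M, TangentSpace (𝓡 (2 * n + 1)) p
  smooth_theta : ContMDiff (𝓡 (2 * n + 1))
    ((𝓡 (2 * n + 1)).prod 𝓘(ℝ, EuclideanSpace ℝ (Fin (2 * n + 1)) →L[ℝ] ℝ)) ∞
    (fun p => TotalSpace.mk' (EuclideanSpace ℝ (Fin (2 * n + 1)) →L[ℝ] ℝ)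
      (E := fun p : M => TangentSpace (𝓡 (2 * n + 1)) p →L[ℝ] ℝ) p (theta p))
  smooth_J : ContMDiff (𝓡 (2 * n + 1))
    ((𝓡 (2 * n + 1)).prod 𝓘(ℝ, EuclideanSpace ℝ (Fin (2 * n + 1)) →L[ℝ]
      EuclideanSpace ℝ (Fin (2 * n + 1)))) ∞
    (fun p => TotalSpace.mk' (EuclideanSpace ℝ (Fin (2 * n + 1)) →L[ℝ]
      EuclideanSpace ℝ (Fin (2 * n + 1)))
      (E := fun p : M => TangentSpace (𝓡 (2 * n + 1)) p →L[ℝ]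
        TangentSpace (𝓡 (2 * n + 1)) p) p (J p))
  smooth_reeb : ∀ p, SmoothFieldAt reeb p
  theta_reeb : ∀ p, theta p (reeb p) = 1
  dtheta_reeb : ∀ p v, extDerivOneForm theta p (reeb p) v = 0
  J_reeb : ∀ p, J p (reeb p) = 0
  theta_J : ∀ p v, theta p (J p v) = 0
  J_J : ∀ p v, theta p v = 0 → J p (J p v) = -v
  /-- Strict pseudoconvexity: `dθ(v, J v) > 0` for nonzero `v` in `H`. -/
  pos : ∀ p v, theta p v = 0 → v ≠ 0 → 0 < extDerivOneForm theta p v (J p v)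
  /-- Formal integrability: the bracket of two local sections of `T^{1,0}` is in `T^{1,0}`. Here
  `A + iB` lies in `T^{1,0}` iff `A` is in `H` and `B = -J A`. -/
  integrable : ∀ (p : M) (Z W : ComplexField (2 * n + 1) M), Z.SmoothAt p → W.SmoothAt p →
    (∀ᶠ q in 𝓝 p, theta q (Z.re q) = 0 ∧ Z.im q = -J q (Z.re q)) →
    (∀ᶠ q in 𝓝 p, theta q (W.re q) = 0 ∧ W.im q = -J q (W.re q)) →
    theta p ((Z.bracket W).re p) = 0 ∧ (Z.bracket W).im p = -J p ((Z.bracket W).re p)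

namespace Pseudohermitian

variable {n : ℕ} {M : Type*} [TopologicalSpace M]
  [ChartedSpace (EuclideanSpace ℝ (Fin (2 * n + 1))) M]
  [IsManifold (𝓡 (2 * n + 1)) ∞ M] (P : Pseudohermitian n M)

/-- The projection of a tangent vector to `H = ker θ` along the Reeb field. -/
def horiz (q : M) (v : TangentSpace (𝓡 (2 * n + 1)) q) : TangentSpace (𝓡 (2 * n + 1)) q :=
  v - P.theta q v • P.reeb q

/-- The `(1,0)`-part of a complex vector field: the projection to `T^{1,0}` in
`ℂ ⊗ TM = T^{1,0} ⊕ T^{0,1} ⊕ ℂ T`, which sends `V` to `(V_H - i J V) / 2`. -/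
def holPart (V : ComplexField (2 * n + 1) M) : ComplexField (2 * n + 1) M where
  re q := (1 / 2 : ℝ) • (P.horiz q (V.re q) + P.J q (V.im q))
  im q := (1 / 2 : ℝ) • (P.horiz q (V.im q) - P.J q (V.re q))

/-- The `(0,1)`-part of a complex vector field: the projection to `T^{0,1}` in
`ℂ ⊗ TM = T^{1,0} ⊕ T^{0,1} ⊕ ℂ T`, which sends `V` to `(V_H + i J V) / 2`. -/
def antiholPart (V : ComplexField (2 * n + 1) M) : ComplexField (2 * n + 1) M where
  re q := (1 / 2 : ℝ) • (P.horiz q (V.re q) - P.J q (V.im q))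
  im q := (1 / 2 : ℝ) • (P.horiz q (V.im q) + P.J q (V.re q))

/-- The Tanaka-Webster derivative `∇_Z W` for `Z` of type `(1,0)` and `W` of type `(0,1)`. As the
connection preserves types and `∇_Z W - ∇_W Z - [Z, W]` is a multiple of the Reeb field,
it is the `(0,1)`-part of `[Z, W]`. -/
def nablaMixed (Z W : ComplexField (2 * n + 1) M) : ComplexField (2 * n + 1) M :=
  P.antiholPart (Z.bracket W)

/-- The second covariant derivative `∇²f(Z, W) = Z (W f) - (∇_Z W) f`, for `Z` of type `(1,0)`
and `W` of type `(0,1)`. -/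
def hessMixed (f : M → ℂ) (Z W : ComplexField (2 * n + 1) M) (p : M) : ℂ :=
  Z.apply (W.apply f) p - (P.nablaMixed Z W).apply f p

/-- The adapted Riemannian metric `g_θ(u, v) = dθ(u, J v) + θ(u) θ(v)`. -/
def adaptedMetric (p : M) (u v : TangentSpace (𝓡 (2 * n + 1)) p) : ℝ :=
  extDerivOneForm P.theta p u (P.J p v) + P.theta p u * P.theta p v

/-- The standard basis vectors of the tangent space, identified with the model space. -/
def basisVec (p : M) (i : Fin (2 * n + 1)) : TangentSpace (𝓡 (2 * n + 1)) p :=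
  (EuclideanSpace.single i (1 : ℝ) : EuclideanSpace ℝ (Fin (2 * n + 1)))

/-- The matrix of `g_θ` at `p` in the standard basis. -/
def metricMatrix (p : M) : Matrix (Fin (2 * n + 1)) (Fin (2 * n + 1)) ℝ :=
  Matrix.of fun i j => P.adaptedMetric p (basisVec p i) (basisVec p j)

/-- The local real frame given by the standard basis at `p`, as complex vector fields. -/
def frameField (p : M) (i : Fin (2 * n + 1)) : ComplexField (2 * n + 1) M where
  re := extendField (basisVec p i)
  im _ := 0

/-- The Kohn Laplacian `□_b f = -h^{αβ̄} ∇_α ∇_β̄ f` on functions, i.e. `-∑_α ∇²f(Z_α, Z̄_α)` for a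
basis `Z_1, …, Z_n` of `T^{1,0}` that is unitary for the Levi metric `-i dθ(Z, W̄)`. It is the
formal expression of `∂̄_b^* ∂̄_b`. For a basis `(e_i)` of the real tangent space one has
`∑_α Z_α ⊗ Z̄_α = ∑_{i,j} g^{ij} e_i^{1,0} ⊗ e_j^{0,1}` with `(g^{ij})` the inverse matrix of `g_θ`,
and this expresses the trace through the standard basis, without a choice of the `Z_α`. -/
def kohnLaplacian (f : M → ℂ) (p : M) : ℂ :=
  -∑ i, ∑ j, ((P.metricMatrix p)⁻¹ i j : ℂ) *
    P.hessMixed f (P.holPart (frameField p i)) (P.antiholPart (frameField p j)) p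

end Pseudohermitian

/-! ## The Euclidean space `ℂ^N` and its spheres -/

section Euclidean

variable {N : ℕ}

/-- The form `ω = i ∂∂̄‖Z‖² = i ∑ dZ^A ∧ dZ̄^A` on `ℂ^N` (it is real-valued). -/
def kahlerForm (u v : EuclideanSpace ℂ (Fin N)) : ℝ :=
  (Complex.I * ∑ A, (u A * conj (v A) - v A * conj (u A))).re

/-- The form `i ∂̄‖Z‖² = i ∑ Z^A dZ̄^A` at the point `z`, evaluated at a vector `v`. It is real on
the vectors tangent to the sphere centred at `0`, where it is the standard pseudohermitian
structure `Θ`. -/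
def sphereTheta (z v : EuclideanSpace ℂ (Fin N)) : ℝ :=
  (Complex.I * ∑ A, z A * conj (v A)).re

/-- `v` is tangent at `z` to the sphere centred at `0` through `z`. -/
def SphereTangent (z v : EuclideanSpace ℂ (Fin N)) : Prop :=
  (∑ A, conj (z A) * v A).re = 0

/-- `v` is in the maximal complex subspace of the tangent space at `z` of the sphere. -/
def SphereHolTangent (z v : EuclideanSpace ℂ (Fin N)) : Prop :=
  SphereTangent z v ∧ SphereTangent z (Complex.I • v)

/-- `t` is the Reeb vector at `z` of the sphere with its standard pseudohermitian structure `Θ`: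
it is tangent, `Θ(t) = 1`, and `dΘ(t, ·) = 0` on tangent vectors, where `dΘ` is the restriction
of `ω`. -/
def IsSphereReeb (z t : EuclideanSpace ℂ (Fin N)) : Prop :=
  SphereTangent z t ∧ sphereTheta z t = 1 ∧ ∀ v, SphereTangent z v → kahlerForm t v = 0

end Euclidean

/-! ## Immersions -/

namespace Pseudohermitian

variable {n : ℕ} {M : Type*} [TopologicalSpace M]
  [ChartedSpace (EuclideanSpace ℝ (Fin (2 * n + 1))) M]
  [IsManifold (𝓡 (2 * n + 1)) ∞ M] (P : Pseudohermitian n M) {N : ℕ}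

/-- A smooth CR immersion `F : M → ℂ^N`: the differential is injective and complex linear on `H`. -/
structure IsCRImmersion (F : M → EuclideanSpace ℂ (Fin N)) : Prop where
  smooth : ContMDiff (𝓡 (2 * n + 1)) 𝓘(ℝ, EuclideanSpace ℂ (Fin N)) ∞ F
  immersion : ∀ p : M, Function.Injective (dirDeriv (m := 2 * n + 1) F p)
  cr : ∀ p v, P.theta p v = 0 → dirDeriv F p (P.J p v) = Complex.I • dirDeriv F p v

/-- A semi-isometric CR immersion into `(ℂ^N, ω)`: `dθ = F^* ω`. -/
structure IsSemiIsometric (F : M → EuclideanSpace ℂ (Fin N)) : Prop extends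
    P.IsCRImmersion F where
  pullback : ∀ p u v, extDerivOneForm P.theta p u v = kahlerForm (dirDeriv F p u) (dirDeriv F p v)

/-- A pseudohermitian immersion of `(M, θ)` into the sphere `r · S^{2N-1}` in `ℂ^N` with its
standard pseudohermitian structure `Θ`: a CR immersion into the sphere with `F^* Θ = θ` that maps
the Reeb field of `θ` to that of `Θ`. -/
structure IsPseudohermitianImmersionIntoSphere (r : ℝ) (F : M → EuclideanSpace ℂ (Fin N)) : Prop
    extends P.IsCRImmersion F where
  mem_sphere : ∀ p, F p ∈ Metric.sphere (0 : EuclideanSpace ℂ (Fin N)) r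
  hol_tangent : ∀ p v, P.theta p v = 0 → SphereHolTangent (F p) (dirDeriv F p v)
  pullback : ∀ p v, sphereTheta (F p) (dirDeriv F p v) = P.theta p v
  map_reeb : ∀ p, IsSphereReeb (F p) (dirDeriv F p (P.reeb p))

end Pseudohermitian

end

/-!
On a function `f` annihilated by `T^{1,0}`, the second covariant derivative reduces to a commutator:
`∇²f(Z, W) = Z W f - (∇_Z W) f = [Z, W] f - [Z, W]^{0,1} f = θ([Z, W]) T f = -dθ(Z, W) T f`.
Its trace for the Levi form is a multiple of `T f`, so that `□_b f = i n T f`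
(`Pseudohermitian.kohnLaplacian_of_isAntiCR`). The ingredients are the formula
`[X, Y] f = X Y f - Y X f` (`dirDeriv_mlieBracket`), the tensoriality of `dθ`, and the
`J`-invariance of `dθ`, which is where integrability enters (`Pseudohermitian.dtheta_J_J`).

For a CR map `Z` the components of `Z̄` are such functions, and `□_b Z̄ = λ Z̄` becomes the equation
`dZ(T) = i μ Z` with `μ = λ̄ / n`. If `Z` is semi-isometric, `0 = dθ(T, v) = ω(i μ Z, dZ(v))` for all
`v`; using this for `v` and `J v`, the vector `Z` is Hermitian orthogonal to `dZ(H)`. Hence the form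
`η = Z^*(i ∂̄‖Z‖²)` vanishes on `H`, i.e. `η = c θ` with `c = η(T) = Re μ ‖Z‖²`. On `H × H` one has
`dη = c dθ`, and also `dη = Z^* ω = dθ`, so `c = 1`
(`Pseudohermitian.IsSemiIsometric.sphereTheta_reeb_eq_one`). This holds at every point, so `‖Z‖²` is
the constant `1 / Re μ` even when `M` is disconnected. Finally `0 = T ‖Z‖² = -2 Im μ ‖Z‖²` shows that
`μ` is real.

Conversely, the Reeb vector of the sphere of radius `r` at `z` is `i z / r²` (`isSphereReeb_iff`), so
a pseudohermitian immersion satisfies `dF(T) = i F / r²`, and the formula for `□_b` applies.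
-/

/-! ### Lie brackets in a chart -/

section Brackets

variable {m : ℕ} {M : Type*} [TopologicalSpace M] [ChartedSpace (EuclideanSpace ℝ (Fin m)) M]
variable [IsManifold (𝓡 m) ∞ M] {V : Type*} [NormedAddCommGroup V] [NormedSpace ℝ V]

/-- The coordinate expression of a vector field in the preferred chart at `p`. -/
noncomputable def chartField (p : M) (X : ∀ q : M, TangentSpace (𝓡 m) q)
    (y : EuclideanSpace ℝ (Fin m)) : EuclideanSpace ℝ (Fin m) :=
  mpullbackWithin 𝓘(ℝ, EuclideanSpace ℝ (Fin m)) (𝓡 m) (extChartAt (𝓡 m) p).symm X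
    (Set.range (𝓡 m)) y

theorem chartField_differentiableAt {p : M} {X : ∀ q : M, TangentSpace (𝓡 m) q}
    (hX : MDifferentiableAt (𝓡 m) (𝓡 m).tangent (fun q => (⟨q, X q⟩ : TangentBundle (𝓡 m) M)) p) :
    DifferentiableAt ℝ (chartField p X) (extChartAt (𝓡 m) p p) := by
  have : IsManifold (𝓡 m) 2 M := inferInstance
  have h := (mdifferentiableWithinAt_univ.2 hX).differentiableWithinAt_mpullbackWithin_vectorField
  have hs : (extChartAt (𝓡 m) p).symm ⁻¹' Set.univ ∩ Set.range (𝓡 m) = Set.univ := by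
    simp
  rw [hs] at h
  exact differentiableWithinAt_univ.1 h

theorem dirDeriv_eq_fderiv_chart {f : M → V} (hf : ContMDiff (𝓡 m) 𝓘(ℝ, V) ∞ f) {p q : M}
    (hq : q ∈ (extChartAt (𝓡 m) p).source) (X : ∀ q : M, TangentSpace (𝓡 m) q) :
    dirDeriv f q (X q) = fderiv ℝ (f ∘ (extChartAt (𝓡 m) p).symm) (extChartAt (𝓡 m) p q)
      (chartField p X (extChartAt (𝓡 m) p q)) := by
  have : IsManifold (𝓡 m) 1 M := inferInstance
  have hy := (extChartAt (𝓡 m) p).map_source hq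
  have hinv := isInvertible_mfderivWithin_extChartAt_symm hy
  have hl : (extChartAt (𝓡 m) p).symm (extChartAt (𝓡 m) p q) = q :=
    (extChartAt (𝓡 m) p).left_inv hq
  have h1 := mfderiv_comp_mfderivWithin (I := 𝓘(ℝ, EuclideanSpace ℝ (Fin m))) (I' := 𝓡 m)
    (I'' := 𝓘(ℝ, V)) (g := f) (f := (extChartAt (𝓡 m) p).symm) (s := Set.range (𝓡 m))
    (extChartAt (𝓡 m) p q)
    (hf.mdifferentiable (by simp) _)
    (mdifferentiableWithinAt_extChartAt_symm hy)
    ((𝓡 m).uniqueMDiffOn _ (extChartAt_target_subset_range p hy))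
  have h2 : fderiv ℝ (f ∘ (extChartAt (𝓡 m) p).symm) (extChartAt (𝓡 m) p q) =
      mfderivWithin 𝓘(ℝ, EuclideanSpace ℝ (Fin m)) 𝓘(ℝ, V) (f ∘ (extChartAt (𝓡 m) p).symm)
        (Set.range (𝓡 m)) (extChartAt (𝓡 m) p q) := by
    rw [(𝓡 m).range_eq_univ, mfderivWithin_univ, mfderiv_eq_fderiv]
  rw [h2, h1]
  obtain ⟨e, he⟩ := hinv
  have h3 : chartField p X (extChartAt (𝓡 m) p q) = e.symm
      (X ((extChartAt (𝓡 m) p).symm (extChartAt (𝓡 m) p q))) := by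
    simp only [chartField, mpullbackWithin_apply, ← he]
    rw [ContinuousLinearMap.inverse_equiv]
    rfl
  rw [h3, ← he]
  change _ = mfderiv (𝓡 m) 𝓘(ℝ, V) f _ (e (e.symm _))
  rw [e.apply_symm_apply, hl]
  rfl

/-- The tangent space at `p` is identified with the model space through the chart at `p`, so the
coordinate expression has the same value at the base point. -/
theorem chartField_apply_self (p : M) (X : ∀ q : M, TangentSpace (𝓡 m) q) :
    chartField p X (extChartAt (𝓡 m) p p) = X p := by
  have : IsManifold (𝓡 m) 1 M := inferInstance
  have h := mfderivWithin_range_extChartAt_symm (I := 𝓡 m) (x := p)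
  unfold chartField
  rw [mpullbackWithin_apply, h]
  erw [ContinuousLinearMap.inverse_id]
  change X ((extChartAt (𝓡 m) p).symm (extChartAt (𝓡 m) p p)) = X p
  rw [extChartAt_to_inv]

theorem mlieBracket_eq_lieBracket_chartField (p : M) (X Y : ∀ q : M, TangentSpace (𝓡 m) q) :
    mlieBracket (𝓡 m) X Y p =
      lieBracket ℝ (chartField p X) (chartField p Y) (extChartAt (𝓡 m) p p) := by
  have : IsManifold (𝓡 m) 1 M := inferInstance
  unfold mlieBracket
  rw [mlieBracketWithin_apply, mfderiv_extChartAt_self]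
  have hs : (extChartAt (𝓡 m) p).symm ⁻¹' Set.univ ∩ Set.range (𝓡 m) = Set.univ := by
    simp
  rw [hs]
  erw [ContinuousLinearMap.inverse_id, lieBracketWithin_univ]
  rfl

theorem contDiffAt_comp_extChartAt_symm {f : M → V} (hf : ContMDiff (𝓡 m) 𝓘(ℝ, V) ∞ f) (p : M) :
    ContDiffAt ℝ ∞ (f ∘ (extChartAt (𝓡 m) p).symm) (extChartAt (𝓡 m) p p) := by
  have h := (contMDiffOn_extChartAt_symm (I := 𝓡 m) (n := ∞) p).contMDiffAt
    (extChartAt_target_mem_nhds p)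
  exact (hf.contMDiffAt.comp (extChartAt (𝓡 m) p p) h).contDiffAt

/-- In the chart at `p` the function `Y f` is the pairing `Df̂(Ŷ)`. It is therefore differentiable
at `p`, and its derivative is given by the product rule. -/
theorem mdifferentiableAt_dirDeriv_and_eq {f : M → V} (hf : ContMDiff (𝓡 m) 𝓘(ℝ, V) ∞ f) {p : M}
    {Y : ∀ q : M, TangentSpace (𝓡 m) q}
    (hY : MDifferentiableAt (𝓡 m) (𝓡 m).tangent (fun q => (⟨q, Y q⟩ : TangentBundle (𝓡 m) M)) p) :
    MDifferentiableAt (𝓡 m) 𝓘(ℝ, V) (fun q => dirDeriv f q (Y q)) p ∧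
    ∀ v : TangentSpace (𝓡 m) p, dirDeriv (fun q => dirDeriv f q (Y q)) p v =
      fderiv ℝ (fderiv ℝ (f ∘ (extChartAt (𝓡 m) p).symm)) (extChartAt (𝓡 m) p p) v
          (chartField p Y (extChartAt (𝓡 m) p p)) +
      fderiv ℝ (f ∘ (extChartAt (𝓡 m) p).symm) (extChartAt (𝓡 m) p p)
        (fderiv ℝ (chartField p Y) (extChartAt (𝓡 m) p p) v) := by
  have : IsManifold (𝓡 m) 1 M := inferInstance
  set φ := extChartAt (𝓡 m) p with hφ
  have hfd : DifferentiableAt ℝ (fderiv ℝ (f ∘ φ.symm)) (φ p) :=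
    ((contDiffAt_comp_extChartAt_symm hf p).fderiv_right (m := ∞) (by simp)).differentiableAt
      (by simp)
  have hG := hfd.hasFDerivAt.clm_apply (chartField_differentiableAt hY).hasFDerivAt
  have hφd : HasMFDerivAt (𝓡 m) 𝓘(ℝ, EuclideanSpace ℝ (Fin m)) φ p
      (mfderiv (𝓡 m) 𝓘(ℝ, EuclideanSpace ℝ (Fin m)) φ p) :=
    (mdifferentiableAt_extChartAt (mem_chart_source _ p)).hasMFDerivAt
  have hcomp := (HasMFDerivAt.comp p hG.hasMFDerivAt hφd).congr_of_eventuallyEq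
    (f₁ := fun q => dirDeriv f q (Y q)) (by
      filter_upwards [extChartAt_source_mem_nhds (I := 𝓡 m) p] with q hq
      exact dirDeriv_eq_fderiv_chart hf hq Y)
  refine ⟨hcomp.mdifferentiableAt, fun v => ?_⟩
  unfold dirDeriv at hcomp ⊢
  rw [hcomp.mfderiv, hφ, mfderiv_extChartAt_self]
  exact add_comm _ _

/-- The bracket acts on functions as a commutator, `[X, Y] f = X (Y f) - Y (X f)`: in the chart the
second derivatives of `f` cancel by symmetry. -/
theorem dirDeriv_mlieBracket {f : M → V} (hf : ContMDiff (𝓡 m) 𝓘(ℝ, V) ∞ f) {p : M}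
    {X Y : ∀ q : M, TangentSpace (𝓡 m) q}
    (hX : MDifferentiableAt (𝓡 m) (𝓡 m).tangent (fun q => (⟨q, X q⟩ : TangentBundle (𝓡 m) M)) p)
    (hY : MDifferentiableAt (𝓡 m) (𝓡 m).tangent (fun q => (⟨q, Y q⟩ : TangentBundle (𝓡 m) M)) p) :
    dirDeriv f p (mlieBracket (𝓡 m) X Y p) =
      dirDeriv (fun q => dirDeriv f q (Y q)) p (X p) -
        dirDeriv (fun q => dirDeriv f q (X q)) p (Y p) := by
  have h : ∀ (Z : ∀ q : M, TangentSpace (𝓡 m) q), dirDeriv f p (Z p) =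
      fderiv ℝ (f ∘ (extChartAt (𝓡 m) p).symm) (extChartAt (𝓡 m) p p) (Z p) := fun Z => by
    rw [dirDeriv_eq_fderiv_chart hf (mem_extChartAt_source p), chartField_apply_self]
  have hsymm := ((contDiffAt_comp_extChartAt_symm hf p).isSymmSndFDerivAt
    (by simpa using ENat.LEInfty.out)).eq
    (X p) (Y p)
  rw [h (mlieBracket (𝓡 m) X Y), mlieBracket_eq_lieBracket_chartField, lieBracket,
    (mdifferentiableAt_dirDeriv_and_eq hf hX).2, (mdifferentiableAt_dirDeriv_and_eq hf hY).2,
    chartField_apply_self, chartField_apply_self, map_sub, hsymm]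
  abel

end Brackets

/-! ### Tensoriality of the exterior derivative of a one-form -/

section Tensoriality

variable {m : ℕ} {M : Type*} [TopologicalSpace M] [ChartedSpace (EuclideanSpace ℝ (Fin m)) M]
variable [IsManifold (𝓡 m) ∞ M] {V : Type*} [NormedAddCommGroup V] [NormedSpace ℝ V]

omit [IsManifold (𝓡 m) ∞ M] in
theorem dirDeriv_eq_mvfderiv (f : M → V) (p : M) (v : TangentSpace (𝓡 m) p) :
    dirDeriv f p v = mvfderiv (𝓡 m) f p v := rfl

variable (m M) in
/-- A smooth one-form, as a section of the bundle `Hom(TM, ℝ)`. -/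
def SmoothOneForm (θ : ∀ q : M, TangentSpace (𝓡 m) q →L[ℝ] ℝ) : Prop :=
  ContMDiff (𝓡 m) ((𝓡 m).prod 𝓘(ℝ, EuclideanSpace ℝ (Fin m) →L[ℝ] ℝ)) ∞
    (fun p => TotalSpace.mk' (EuclideanSpace ℝ (Fin m) →L[ℝ] ℝ)
      (E := fun p : M => TangentSpace (𝓡 m) p →L[ℝ] ℝ) p (θ p))

theorem SmoothFieldAt.mdifferentiableAt {X : ∀ q : M, TangentSpace (𝓡 m) q} {p : M}
    (hX : SmoothFieldAt X p) :
    MDifferentiableAt (𝓡 m) (𝓡 m).tangent (fun q => (⟨q, X q⟩ : TangentBundle (𝓡 m) M)) p :=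
  ContMDiffAt.mdifferentiableAt hX (by simp)

theorem smoothFieldAt_extendField {p : M} (v : TangentSpace (𝓡 m) p) :
    SmoothFieldAt (extendField v) p :=
  FiberBundle.contMDiffAt_extend _ _ v

@[simp]
theorem extendField_self {p : M} (v : TangentSpace (𝓡 m) p) : extendField v p = v := by
  simp [extendField]

theorem SmoothOneForm.mdifferentiableAt_apply {θ : ∀ q : M, TangentSpace (𝓡 m) q →L[ℝ] ℝ}
    (hθ : SmoothOneForm m M θ) {X : ∀ q : M, TangentSpace (𝓡 m) q} {p : M}
    (hX : MDifferentiableAt (𝓡 m) (𝓡 m).tangent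
      (fun q => (⟨q, X q⟩ : TangentBundle (𝓡 m) M)) p) :
    MDifferentiableAt (𝓡 m) 𝓘(ℝ, ℝ) (fun q => θ q (X q)) p := by
  have h1 := (hθ p).mdifferentiableAt (by simp)
  have h2 := MDifferentiableAt.clm_bundle_apply (E₁ := fun q : M => TangentSpace (𝓡 m) q)
    (E₂ := Bundle.Trivial M ℝ) (b := id) h1 hX
  exact ((mdifferentiableAt_totalSpace _ _).1 h2).2

theorem SmoothOneForm.contMDiffAt_apply {θ : ∀ q : M, TangentSpace (𝓡 m) q →L[ℝ] ℝ}
    (hθ : SmoothOneForm m M θ) {X : ∀ q : M, TangentSpace (𝓡 m) q} {p : M}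
    (hX : SmoothFieldAt X p) :
    ContMDiffAt (𝓡 m) 𝓘(ℝ, ℝ) ∞ (fun q => θ q (X q)) p := by
  have h2 := ContMDiffAt.clm_bundle_apply (E₁ := fun q : M => TangentSpace (𝓡 m) q)
    (E₂ := Bundle.Trivial M ℝ) (b := id) (hθ p) hX
  exact (contMDiffAt_totalSpace.1 h2).2

omit [IsManifold (𝓡 m) ∞ M] in
theorem extDerivField_swap (θ : ∀ q : M, TangentSpace (𝓡 m) q →L[ℝ] ℝ)
    (X Y : ∀ q : M, TangentSpace (𝓡 m) q) (p : M) :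
    extDerivField θ X Y p = -extDerivField θ Y X p := by
  unfold extDerivField
  rw [mlieBracket_swap_apply, map_neg]
  ring

theorem SmoothOneForm.tensorialAt_extDerivField {θ : ∀ q : M, TangentSpace (𝓡 m) q →L[ℝ] ℝ}
    (hθ : SmoothOneForm m M θ) (Y : ∀ q : M, TangentSpace (𝓡 m) q) (p : M) :
    TensorialAt (𝓡 m) (EuclideanSpace ℝ (Fin m)) (fun X => extDerivField θ X Y p) p where
  smul {f X} hf hX := by
    have h1 := mvfderiv_mul hf (hθ.mdifferentiableAt_apply hX)
    have h2 : dirDeriv (fun q => θ q ((f • X) q)) p (Y p) =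
        f p * dirDeriv (fun q => θ q (X q)) p (Y p) + θ p (X p) * dirDeriv f p (Y p) := by
      have := congrArg (fun L => L (Y p)) h1
      simpa using! this
    have h3 := mlieBracket_smul_left (W := Y) hf hX
    unfold extDerivField
    rw [h2, h3]
    simp only [dirDeriv_eq_mvfderiv, Pi.smul_apply', map_add, map_smul, smul_eq_mul]
    ring
  add {X X'} hX hX' := by
    have h1 := mvfderiv_add (hθ.mdifferentiableAt_apply hX) (hθ.mdifferentiableAt_apply hX')
    have h2 : dirDeriv (fun q => θ q ((X + X') q)) p (Y p) =
        dirDeriv (fun q => θ q (X q)) p (Y p) + dirDeriv (fun q => θ q (X' q)) p (Y p) := by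
      have := congrArg (fun L => L (Y p)) h1
      simpa using! this
    have h3 := mlieBracket_add_left (W := Y) hX hX'
    unfold extDerivField
    rw [h2, h3]
    simp only [dirDeriv_eq_mvfderiv, Pi.add_apply, map_add]
    ring

theorem SmoothOneForm.tensorialAt_extDerivField_right
    {θ : ∀ q : M, TangentSpace (𝓡 m) q →L[ℝ] ℝ}
    (hθ : SmoothOneForm m M θ) (X : ∀ q : M, TangentSpace (𝓡 m) q) (p : M) :
    TensorialAt (𝓡 m) (EuclideanSpace ℝ (Fin m)) (fun Y => extDerivField θ X Y p) p where
  smul {f Y} hf hY := by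
    rw [extDerivField_swap, (hθ.tensorialAt_extDerivField X p).smul hf hY, extDerivField_swap θ X]
    simp
  add {Y Y'} hY hY' := by
    rw [extDerivField_swap, (hθ.tensorialAt_extDerivField X p).add hY hY', extDerivField_swap θ X,
      extDerivField_swap θ X Y']
    ring

/-- The exterior derivative `dθ_p` as a continuous bilinear form. Tensoriality makes it independent
of the local extensions in `extDerivOneForm`. -/
noncomputable def SmoothOneForm.extDeriv {θ : ∀ q : M, TangentSpace (𝓡 m) q →L[ℝ] ℝ}
    (hθ : SmoothOneForm m M θ) (p : M) :
    TangentSpace (𝓡 m) p →L[ℝ] TangentSpace (𝓡 m) p →L[ℝ] ℝ :=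
  TensorialAt.mkHom₂ (I := 𝓡 m) (F := EuclideanSpace ℝ (Fin m)) (F' := EuclideanSpace ℝ (Fin m))
    (fun X Y => extDerivField θ X Y p) p
    (fun Y _ => hθ.tensorialAt_extDerivField Y p)
    (fun X _ => hθ.tensorialAt_extDerivField_right X p)

theorem SmoothOneForm.extDerivField_eq {θ : ∀ q : M, TangentSpace (𝓡 m) q →L[ℝ] ℝ}
    (hθ : SmoothOneForm m M θ) {p : M} {X Y : ∀ q : M, TangentSpace (𝓡 m) q}
    (hX : SmoothFieldAt X p) (hY : SmoothFieldAt Y p) :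
    hθ.extDeriv p (X p) (Y p) = extDerivField θ X Y p :=
  TensorialAt.mkHom₂_apply _ _ hX.mdifferentiableAt hY.mdifferentiableAt

theorem SmoothOneForm.extDeriv_swap {θ : ∀ q : M, TangentSpace (𝓡 m) q →L[ℝ] ℝ}
    (hθ : SmoothOneForm m M θ) (p : M) (u v : TangentSpace (𝓡 m) p) :
    hθ.extDeriv p u v = -hθ.extDeriv p v u :=
  extDerivField_swap _ _ _ _

/-- On sections of the kernel of `θ`, `dθ(X, Y) = -θ([X, Y])`. -/
theorem SmoothOneForm.extDeriv_eq_neg_bracket {θ : ∀ q : M, TangentSpace (𝓡 m) q →L[ℝ] ℝ}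
    (hθ : SmoothOneForm m M θ) {p : M} {X Y : ∀ q : M, TangentSpace (𝓡 m) q}
    (hX : SmoothFieldAt X p) (hY : SmoothFieldAt Y p)
    (hX0 : ∀ q, θ q (X q) = 0) (hY0 : ∀ q, θ q (Y q) = 0) :
    hθ.extDeriv p (X p) (Y p) = -θ p (mlieBracket (𝓡 m) X Y p) := by
  rw [hθ.extDerivField_eq hX hY]
  unfold extDerivField
  simp [hX0, hY0, dirDeriv_eq_mvfderiv, mvfderiv_const]

end Tensoriality

/-! ### Complex vector fields and the `J`-invariance of `dθ` -/

section ComplexFields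

variable {m : ℕ} {M : Type*} [TopologicalSpace M] [ChartedSpace (EuclideanSpace ℝ (Fin m)) M]

theorem dirDeriv_add {V : Type*} [NormedAddCommGroup V] [NormedSpace ℝ V] (f : M → V) (p : M)
    (u v : TangentSpace (𝓡 m) p) : dirDeriv f p (u + v) = dirDeriv f p u + dirDeriv f p v :=
  map_add (mvfderiv (𝓡 m) f p) u v

theorem dirDeriv_sub {V : Type*} [NormedAddCommGroup V] [NormedSpace ℝ V] (f : M → V) (p : M)
    (u v : TangentSpace (𝓡 m) p) : dirDeriv f p (u - v) = dirDeriv f p u - dirDeriv f p v :=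
  map_sub (mvfderiv (𝓡 m) f p) u v

theorem dirDeriv_smul {V : Type*} [NormedAddCommGroup V] [NormedSpace ℝ V] (f : M → V) (p : M)
    (c : ℝ) (v : TangentSpace (𝓡 m) p) : dirDeriv f p (c • v) = c • dirDeriv f p v :=
  map_smul (mvfderiv (𝓡 m) f p) c v

theorem dirDeriv_clm_comp {V W : Type*} [NormedAddCommGroup V] [NormedSpace ℝ V]
    [NormedAddCommGroup W] [NormedSpace ℝ W] (L : V →L[ℝ] W) {f : M → V} {p : M}
    (hf : MDifferentiableAt (𝓡 m) 𝓘(ℝ, V) f p) (v : TangentSpace (𝓡 m) p) :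
    dirDeriv (fun q => L (f q)) p v = L (dirDeriv f p v) := by
  have h := (HasMFDerivAt.comp p (L.hasFDerivAt (x := f p)).hasMFDerivAt hf.hasMFDerivAt).mfderiv
  exact congrArg (fun T => T v) h

variable [IsManifold (𝓡 m) ∞ M]

theorem dirDeriv_apply_field {f : M → ℂ} (hf : ContMDiff (𝓡 m) 𝓘(ℝ, ℂ) ∞ f) {p : M}
    {W : ComplexField m M} (hW : W.SmoothAt p) (v : TangentSpace (𝓡 m) p) :
    dirDeriv (W.apply f) p v = dirDeriv (fun q => dirDeriv f q (W.re q)) p v +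
      Complex.I * dirDeriv (fun q => dirDeriv f q (W.im q)) p v := by
  have h1 := (mdifferentiableAt_dirDeriv_and_eq hf hW.1.mdifferentiableAt).1
  have h2 := (mdifferentiableAt_dirDeriv_and_eq hf hW.2.mdifferentiableAt).1
  let L : ℂ →L[ℝ] ℂ := ContinuousLinearMap.mul ℝ ℂ Complex.I
  have h2' : MDifferentiableAt (𝓡 m) 𝓘(ℝ, ℂ) (fun q => L (dirDeriv f q (W.im q))) p :=
    L.differentiableAt.mdifferentiableAt.comp p h2
  have h := congrArg (fun T => T v) (mvfderiv_add h1 h2')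
  exact h.trans (congrArg
    (fun z => dirDeriv (fun q => dirDeriv f q (W.re q)) p v + z) (dirDeriv_clm_comp L h2 v))

theorem ComplexField.apply_bracket {f : M → ℂ} (hf : ContMDiff (𝓡 m) 𝓘(ℝ, ℂ) ∞ f) {p : M}
    {Z W : ComplexField m M} (hZ : Z.SmoothAt p) (hW : W.SmoothAt p) :
    (Z.bracket W).apply f p = Z.apply (W.apply f) p - W.apply (Z.apply f) p := by
  have hb := fun {X Y : ∀ q : M, TangentSpace (𝓡 m) q} (hX : SmoothFieldAt X p)
    (hY : SmoothFieldAt Y p) =>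
    dirDeriv_mlieBracket hf hX.mdifferentiableAt hY.mdifferentiableAt
  rw [ComplexField.apply, ComplexField.apply, ComplexField.apply, dirDeriv_apply_field hf hW,
    dirDeriv_apply_field hf hW, dirDeriv_apply_field hf hZ, dirDeriv_apply_field hf hZ]
  simp only [ComplexField.bracket, dirDeriv_add, dirDeriv_sub, hb hZ.1 hW.1, hb hZ.2 hW.2,
    hb hZ.1 hW.2, hb hZ.2 hW.1]
  linear_combination (dirDeriv (fun q => dirDeriv f q (Z.im q)) p (W.im p) -
    dirDeriv (fun q => dirDeriv f q (W.im q)) p (Z.im p)) * Complex.I_mul_I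

end ComplexFields

namespace Pseudohermitian

variable {n : ℕ} {M : Type*} [TopologicalSpace M]
  [ChartedSpace (EuclideanSpace ℝ (Fin (2 * n + 1))) M]
  [IsManifold (𝓡 (2 * n + 1)) ∞ M] (P : Pseudohermitian n M)

theorem smoothOneForm_theta : SmoothOneForm (2 * n + 1) M P.theta := P.smooth_theta

/-- The bilinear form `dθ_p`. -/
noncomputable def dtheta (p : M) :
    TangentSpace (𝓡 (2 * n + 1)) p →L[ℝ] TangentSpace (𝓡 (2 * n + 1)) p →L[ℝ] ℝ :=
  P.smoothOneForm_theta.extDeriv p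

theorem dtheta_apply (p : M) (u v : TangentSpace (𝓡 (2 * n + 1)) p) :
    P.dtheta p u v = extDerivOneForm P.theta p u v := rfl

theorem dtheta_swap (p : M) (u v : TangentSpace (𝓡 (2 * n + 1)) p) :
    P.dtheta p u v = -P.dtheta p v u :=
  P.smoothOneForm_theta.extDeriv_swap p u v

theorem theta_horiz (p : M) (v : TangentSpace (𝓡 (2 * n + 1)) p) : P.theta p (P.horiz p v) = 0 := by
  simp [horiz, P.theta_reeb]

theorem J_horiz (p : M) (v : TangentSpace (𝓡 (2 * n + 1)) p) :
    P.J p (P.horiz p v) = P.J p v := by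
  simp [horiz, P.J_reeb]

theorem horiz_eq_self {p : M} {v : TangentSpace (𝓡 (2 * n + 1)) p} (h : P.theta p v = 0) :
    P.horiz p v = v := by
  simp [horiz, h]

theorem dtheta_horiz_left (p : M) (u v : TangentSpace (𝓡 (2 * n + 1)) p) :
    P.dtheta p (P.horiz p u) v = P.dtheta p u v := by
  simp [horiz, dtheta_apply, P.dtheta_reeb]

theorem dtheta_horiz_right (p : M) (u v : TangentSpace (𝓡 (2 * n + 1)) p) :
    P.dtheta p u (P.horiz p v) = P.dtheta p u v := by
  rw [dtheta_swap, dtheta_horiz_left, ← dtheta_swap]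

variable {P} in
theorem smoothFieldAt_J {X : ∀ q : M, TangentSpace (𝓡 (2 * n + 1)) q} {p : M}
    (hX : SmoothFieldAt X p) : SmoothFieldAt (fun q => P.J q (X q)) p :=
  ContMDiffAt.clm_bundle_apply (E₁ := fun q : M => TangentSpace (𝓡 (2 * n + 1)) q)
    (E₂ := fun q : M => TangentSpace (𝓡 (2 * n + 1)) q) (b := id) (P.smooth_J p) hX

variable {P} in
theorem smoothFieldAt_horiz {X : ∀ q : M, TangentSpace (𝓡 (2 * n + 1)) q} {p : M}
    (hX : SmoothFieldAt X p) : SmoothFieldAt (fun q => P.horiz q (X q)) p :=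
  ContMDiffAt.sub_section hX
    (ContMDiffAt.smul_section (P.smoothOneForm_theta.contMDiffAt_apply hX) (P.smooth_reeb p))

/-- Integrability makes `dθ` invariant under `J`. -/
theorem dtheta_J_J (p : M) (u v : TangentSpace (𝓡 (2 * n + 1)) p) :
    P.dtheta p (P.J p u) (P.J p v) = P.dtheta p u v := by
  let A : ∀ q : M, TangentSpace (𝓡 (2 * n + 1)) q := fun q => P.horiz q (extendField u q)
  let B : ∀ q : M, TangentSpace (𝓡 (2 * n + 1)) q := fun q => P.horiz q (extendField v q)
  have hA : SmoothFieldAt A p := smoothFieldAt_horiz (smoothFieldAt_extendField u)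
  have hB : SmoothFieldAt B p := smoothFieldAt_horiz (smoothFieldAt_extendField v)
  have hJA : SmoothFieldAt (fun q => P.J q (A q)) p := smoothFieldAt_J hA
  have hJB : SmoothFieldAt (fun q => P.J q (B q)) p := smoothFieldAt_J hB
  have hneg : ∀ {X : ∀ q : M, TangentSpace (𝓡 (2 * n + 1)) q}, SmoothFieldAt X p →
      SmoothFieldAt (fun q => -X q) p := fun hX => ContMDiffAt.neg_section hX
  have h := (P.integrable p ⟨A, fun q => -P.J q (A q)⟩ ⟨B, fun q => -P.J q (B q)⟩
    ⟨hA, hneg hJA⟩ ⟨hB, hneg hJB⟩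
    (.of_forall fun q => ⟨P.theta_horiz _ _, rfl⟩)
    (.of_forall fun q => ⟨P.theta_horiz _ _, rfl⟩)).1
  have h1 := P.smoothOneForm_theta.extDeriv_eq_neg_bracket hA hB (fun q => P.theta_horiz _ _)
    (fun q => P.theta_horiz _ _)
  have h2 := P.smoothOneForm_theta.extDeriv_eq_neg_bracket (hneg hJA) (hneg hJB)
    (fun q => by simp [P.theta_J]) (fun q => by simp [P.theta_J])
  simp only [ComplexField.bracket, map_sub] at h
  have e1 : P.smoothOneForm_theta.extDeriv p (A p) (B p) = P.dtheta p u v := by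
    change P.dtheta p (P.horiz p (extendField u p)) (P.horiz p (extendField v p)) = _
    rw [dtheta_horiz_left, dtheta_horiz_right, extendField_self, extendField_self]
  have e2 : P.smoothOneForm_theta.extDeriv p (-P.J p (A p)) (-P.J p (B p)) =
      P.dtheta p (P.J p u) (P.J p v) := by
    change P.dtheta p (-P.J p (P.horiz p (extendField u p)))
      (-P.J p (P.horiz p (extendField v p))) = _
    rw [J_horiz, J_horiz, extendField_self, extendField_self]
    simp
  linarith

/-- The Levi form `dθ(u, J v)` is symmetric. -/
theorem dtheta_J_symm (p : M) (u v : TangentSpace (𝓡 (2 * n + 1)) p) :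
    P.dtheta p u (P.J p v) = P.dtheta p v (P.J p u) := by
  rw [← dtheta_J_J, ← J_horiz P p v, P.J_J p _ (P.theta_horiz p v), map_neg, dtheta_horiz_right,
    ← dtheta_swap]

end Pseudohermitian

/-! ### The Kohn Laplacian on anti-CR functions -/

namespace Pseudohermitian

variable {n : ℕ} {M : Type*} [TopologicalSpace M]
  [ChartedSpace (EuclideanSpace ℝ (Fin (2 * n + 1))) M]
  [IsManifold (𝓡 (2 * n + 1)) ∞ M] (P : Pseudohermitian n M)

omit [IsManifold (𝓡 (2 * n + 1)) ∞ M] in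
theorem sum_smul_basisVec (p : M) (x : Fin (2 * n + 1) → ℝ) :
    ∑ i, x i • (basisVec p i : TangentSpace (𝓡 (2 * n + 1)) p) =
      (WithLp.toLp 2 x : EuclideanSpace ℝ (Fin (2 * n + 1))) := by
  have h : ∑ i, x i • (EuclideanSpace.single i (1 : ℝ) : EuclideanSpace ℝ (Fin (2 * n + 1))) =
      WithLp.toLp 2 x := by
    ext j
    simp [Finset.sum_apply, Pi.single_apply]
  exact h

theorem adaptedMetric_eq (p : M) (u v : TangentSpace (𝓡 (2 * n + 1)) p) :
    P.adaptedMetric p u v = P.dtheta p u (P.J p v) + P.theta p u * P.theta p v := rfl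

theorem metricMatrix_mulVec (p : M) (x : Fin (2 * n + 1) → ℝ) (i : Fin (2 * n + 1)) :
    (P.metricMatrix p).mulVec x i =
      P.adaptedMetric p (basisVec p i) (WithLp.toLp 2 x : EuclideanSpace ℝ (Fin (2 * n + 1))) := by
  have h := sum_smul_basisVec p x
  rw [← h]
  simp only [Matrix.mulVec, dotProduct, metricMatrix, Matrix.of_apply, adaptedMetric_eq, map_sum,
    map_smul, smul_eq_mul, Finset.mul_sum, ← Finset.sum_add_distrib]
  exact Finset.sum_congr rfl fun j _ => by ring

theorem adaptedMetric_sum_left (p : M) (x : Fin (2 * n + 1) → ℝ)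
    (w : TangentSpace (𝓡 (2 * n + 1)) p) :
    ∑ i, x i * P.adaptedMetric p (basisVec p i) w =
      P.adaptedMetric p (WithLp.toLp 2 x : EuclideanSpace ℝ (Fin (2 * n + 1))) w := by
  have h := sum_smul_basisVec p x
  rw [← h]
  simp only [adaptedMetric_eq, map_sum, map_smul, smul_eq_mul, Finset.sum_mul,
    sum_apply, smul_apply, ← Finset.sum_add_distrib]
  exact Finset.sum_congr rfl fun j _ => by ring

theorem eq_zero_of_adaptedMetric_self {p : M} {v : TangentSpace (𝓡 (2 * n + 1)) p}
    (h : P.adaptedMetric p v v = 0) : v = 0 := by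
  by_contra hv
  rw [adaptedMetric_eq, ← dtheta_horiz_left, ← J_horiz] at h
  by_cases h0 : P.horiz p v = 0
  · rw [h0] at h
    have hθ : P.theta p v = 0 := by simpa using h
    exact hv (by rwa [P.horiz_eq_self hθ] at h0)
  · have hpos : 0 < P.dtheta p (P.horiz p v) (P.J p (P.horiz p v)) :=
      P.pos p _ (P.theta_horiz p v) h0
    nlinarith [mul_self_nonneg (P.theta p v)]

theorem isUnit_det_metricMatrix (p : M) : IsUnit (P.metricMatrix p).det := by
  rw [← Matrix.isUnit_iff_isUnit_det, ← Matrix.mulVec_injective_iff_isUnit]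
  refine (injective_iff_map_eq_zero (P.metricMatrix p).mulVecLin).2 fun x hx => ?_
  have hx' : (P.metricMatrix p).mulVec x = 0 := hx
  have h := P.adaptedMetric_sum_left p x (WithLp.toLp 2 x : EuclideanSpace ℝ (Fin (2 * n + 1)))
  simp only [← metricMatrix_mulVec, hx', Pi.zero_apply, mul_zero, Finset.sum_const_zero] at h
  have h0 := P.eq_zero_of_adaptedMetric_self h.symm
  exact congrArg WithLp.ofLp h0

theorem isSymm_metricMatrix (p : M) : (P.metricMatrix p).IsSymm := by
  ext i j
  simp only [Matrix.transpose_apply, metricMatrix, Matrix.of_apply, adaptedMetric_eq]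
  rw [dtheta_J_symm, mul_comm (P.theta p _)]

theorem isSymm_metricMatrix_inv (p : M) : (P.metricMatrix p)⁻¹.IsSymm := by
  rw [Matrix.IsSymm, Matrix.transpose_nonsing_inv, P.isSymm_metricMatrix p]

/-- The trace of a skew form vanishes. -/
theorem sum_inv_metricMatrix_dtheta (p : M) :
    ∑ i, ∑ j, (P.metricMatrix p)⁻¹ i j * P.dtheta p (basisVec p i) (basisVec p j) = 0 := by
  have h : ∑ i, ∑ j, (P.metricMatrix p)⁻¹ i j * P.dtheta p (basisVec p i) (basisVec p j) =
      -∑ i, ∑ j, (P.metricMatrix p)⁻¹ i j * P.dtheta p (basisVec p i) (basisVec p j) := by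
    conv_lhs => rw [Finset.sum_comm]
    rw [← Finset.sum_neg_distrib]
    refine Finset.sum_congr rfl fun i _ => ?_
    rw [← Finset.sum_neg_distrib]
    refine Finset.sum_congr rfl fun j _ => ?_
    rw [(P.isSymm_metricMatrix_inv p).apply, dtheta_swap, mul_neg]
  linarith

/-- The trace of the Levi part of the metric is `2n`, the real rank of `ker θ`. -/
theorem sum_inv_metricMatrix_levi (p : M) :
    ∑ i, ∑ j, (P.metricMatrix p)⁻¹ i j * P.dtheta p (basisVec p i) (P.J p (basisVec p j)) =
      2 * n := by
  have hu := P.isUnit_det_metricMatrix p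
  -- `θ = g(T, ·)`, so that `θ` has norm one for the inverse metric.
  let t : Fin (2 * n + 1) → ℝ := WithLp.ofLp (P.reeb p : EuclideanSpace ℝ (Fin (2 * n + 1)))
  have ht : (P.metricMatrix p).mulVec t = fun i => P.theta p (basisVec p i) := by
    funext i
    rw [metricMatrix_mulVec]
    change P.adaptedMetric p (basisVec p i) (P.reeb p) = _
    rw [adaptedMetric_eq, P.J_reeb, P.theta_reeb]
    simp
  have ht' : (P.metricMatrix p)⁻¹.mulVec (fun i => P.theta p (basisVec p i)) = t := by
    rw [← ht, Matrix.mulVec_mulVec, Matrix.nonsing_inv_mul _ hu, Matrix.one_mulVec]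
  have h1 : ∑ i, ∑ j, (P.metricMatrix p)⁻¹ i j *
      (P.theta p (basisVec p i) * P.theta p (basisVec p j)) = 1 := by
    have e : ∀ i, ∑ j, (P.metricMatrix p)⁻¹ i j *
        (P.theta p (basisVec p i) * P.theta p (basisVec p j)) = t i * P.theta p (basisVec p i) := by
      intro i
      rw [← ht', Matrix.mulVec, dotProduct, Finset.sum_mul]
      exact Finset.sum_congr rfl fun j _ => by ring
    have hs : ∑ i, t i • (basisVec p i : TangentSpace (𝓡 (2 * n + 1)) p) = P.reeb p :=
      sum_smul_basisVec p t
    simp only [e]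
    rw [← P.theta_reeb p, ← hs, map_sum]
    exact Finset.sum_congr rfl fun j _ => by simp
  have h2 : ∑ i, ∑ j, (P.metricMatrix p)⁻¹ i j * P.metricMatrix p i j = 2 * n + 1 := by
    have h3 : ((P.metricMatrix p)⁻¹ * P.metricMatrix p).trace = 2 * n + 1 := by
      rw [Matrix.nonsing_inv_mul _ hu]
      simp
    rw [← h3, Matrix.trace]
    refine Finset.sum_congr rfl fun i _ => ?_
    rw [Matrix.diag_apply, Matrix.mul_apply]
    exact Finset.sum_congr rfl fun j _ => by rw [(P.isSymm_metricMatrix p).apply]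
  have h4 : ∀ i j, (P.metricMatrix p)⁻¹ i j * P.dtheta p (basisVec p i) (P.J p (basisVec p j)) =
      (P.metricMatrix p)⁻¹ i j * P.metricMatrix p i j - (P.metricMatrix p)⁻¹ i j *
      (P.theta p (basisVec p i) * P.theta p (basisVec p j)) := by
    intro i j
    have : P.metricMatrix p i j = P.adaptedMetric p (basisVec p i) (basisVec p j) := rfl
    rw [this, adaptedMetric_eq]
    ring
  simp only [h4, Finset.sum_sub_distrib, h1, h2]
  ring

/-- A function is anti-CR if it is annihilated by `T^{1,0}`: its differential is complex
antilinear on `ker θ`. -/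
def IsAntiCR (f : M → ℂ) : Prop :=
  ∀ q v, P.theta q v = 0 → dirDeriv f q (P.J q v) = -Complex.I * dirDeriv f q v

variable {P} in
theorem IsAntiCR.dirDeriv_J {f : M → ℂ} (hf : P.IsAntiCR f) (q : M)
    (v : TangentSpace (𝓡 (2 * n + 1)) q) :
    dirDeriv f q (P.J q v) = -Complex.I * dirDeriv f q (P.horiz q v) := by
  rw [← hf q _ (P.theta_horiz q v), J_horiz]

variable {P} in
theorem IsAntiCR.holPart_apply {f : M → ℂ} (hf : P.IsAntiCR f) (V : ComplexField (2 * n + 1) M) :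
    (P.holPart V).apply f = fun _ => 0 := by
  funext q
  simp only [ComplexField.apply, holPart, dirDeriv_smul, dirDeriv_add, dirDeriv_sub, hf.dirDeriv_J,
    Complex.real_smul]
  push_cast
  linear_combination (1 / 2 * dirDeriv f q (P.horiz q (V.re q))) * Complex.I_mul_I

variable {P} in
/-- An anti-CR function is differentiated by a complex field through the `(0,1)`-part and the Reeb
part of the field only. -/
theorem IsAntiCR.apply_eq {f : M → ℂ} (hf : P.IsAntiCR f) (V : ComplexField (2 * n + 1) M)
    (q : M) : V.apply f q = (P.antiholPart V).apply f q +
      (P.theta q (V.re q) + Complex.I * P.theta q (V.im q)) * dirDeriv f q (P.reeb q) := by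
  have h : ∀ v, dirDeriv f q v =
      dirDeriv f q (P.horiz q v) + P.theta q v * dirDeriv f q (P.reeb q) := fun v => by
    rw [horiz, dirDeriv_sub, dirDeriv_smul, Complex.real_smul]
    ring
  simp only [ComplexField.apply, antiholPart, dirDeriv_smul, dirDeriv_add, dirDeriv_sub,
    hf.dirDeriv_J, Complex.real_smul]
  rw [h (V.re q), h (V.im q)]
  push_cast
  linear_combination (1 / 2 * dirDeriv f q (P.horiz q (V.re q))) * Complex.I_mul_I

theorem smoothAt_frameField (p : M) (i : Fin (2 * n + 1)) :
    (frameField p i : ComplexField (2 * n + 1) M).SmoothAt p :=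
  ⟨smoothFieldAt_extendField _, ContMDiffAt.congr_of_eventuallyEq
    (Bundle.contMDiff_zeroSection ℝ (TangentSpace (𝓡 (2 * n + 1)) : M → Type _)).contMDiffAt
    (.of_forall fun _ => rfl)⟩

theorem smoothAt_holPart {V : ComplexField (2 * n + 1) M} {p : M} (hV : V.SmoothAt p) :
    (P.holPart V).SmoothAt p :=
  ⟨ContMDiffAt.const_smul_section
      (ContMDiffAt.add_section (smoothFieldAt_horiz hV.1) (smoothFieldAt_J hV.2)),
    ContMDiffAt.const_smul_section
      (ContMDiffAt.sub_section (smoothFieldAt_horiz hV.2) (smoothFieldAt_J hV.1))⟩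

theorem smoothAt_antiholPart {V : ComplexField (2 * n + 1) M} {p : M} (hV : V.SmoothAt p) :
    (P.antiholPart V).SmoothAt p :=
  ⟨ContMDiffAt.const_smul_section
      (ContMDiffAt.sub_section (smoothFieldAt_horiz hV.1) (smoothFieldAt_J hV.2)),
    ContMDiffAt.const_smul_section
      (ContMDiffAt.add_section (smoothFieldAt_horiz hV.2) (smoothFieldAt_J hV.1))⟩

/-- The Reeb component of `[e_i^{1,0}, e_j^{0,1}]`, in terms of the skew form `dθ` and the Levi
form. -/
theorem theta_bracket_holPart_antiholPart (p : M) (i j : Fin (2 * n + 1)) :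
    (P.theta p (((P.holPart (frameField p i)).bracket (P.antiholPart (frameField p j))).re p) : ℂ) +
      Complex.I *
        P.theta p (((P.holPart (frameField p i)).bracket (P.antiholPart (frameField p j))).im p) =
      -(1 / 2) * (P.dtheta p (basisVec p i) (basisVec p j) +
        Complex.I * P.dtheta p (basisVec p i) (P.J p (basisVec p j))) := by
  have hZ := P.smoothAt_holPart (smoothAt_frameField p i)
  have hW := P.smoothAt_antiholPart (smoothAt_frameField p j)
  have k1 : ∀ (V : ComplexField (2 * n + 1) M) q, P.theta q ((P.holPart V).re q) = 0 :=
    fun V q => by simp [holPart, theta_horiz, P.theta_J]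
  have k2 : ∀ (V : ComplexField (2 * n + 1) M) q, P.theta q ((P.holPart V).im q) = 0 :=
    fun V q => by simp [holPart, theta_horiz, P.theta_J]
  have k3 : ∀ (V : ComplexField (2 * n + 1) M) q, P.theta q ((P.antiholPart V).re q) = 0 :=
    fun V q => by simp [antiholPart, theta_horiz, P.theta_J]
  have k4 : ∀ (V : ComplexField (2 * n + 1) M) q, P.theta q ((P.antiholPart V).im q) = 0 :=
    fun V q => by simp [antiholPart, theta_horiz, P.theta_J]
  have hθ := P.smoothOneForm_theta
  have b1 := hθ.extDeriv_eq_neg_bracket hZ.1 hW.1 (k1 _) (k3 _)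
  have b2 := hθ.extDeriv_eq_neg_bracket hZ.2 hW.2 (k2 _) (k4 _)
  have b3 := hθ.extDeriv_eq_neg_bracket hZ.1 hW.2 (k1 _) (k4 _)
  have b4 := hθ.extDeriv_eq_neg_bracket hZ.2 hW.1 (k2 _) (k3 _)
  have h0 : P.horiz p 0 = 0 := by simp [horiz]
  have v1 : (P.holPart (frameField p i)).re p = (1 / 2 : ℝ) • P.horiz p (basisVec p i) := by
    simp [holPart, frameField]
  have v2 : (P.holPart (frameField p i)).im p = -((1 / 2 : ℝ) • P.J p (basisVec p i)) := by
    simp [holPart, frameField, h0]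
  have v3 : (P.antiholPart (frameField p j)).re p = (1 / 2 : ℝ) • P.horiz p (basisVec p j) := by
    simp [antiholPart, frameField]
  have v4 : (P.antiholPart (frameField p j)).im p = (1 / 2 : ℝ) • P.J p (basisVec p j) := by
    simp [antiholPart, frameField, h0]
  change P.dtheta p _ _ = _ at b1 b2 b3 b4
  rw [v1, v3] at b1
  rw [v2, v4] at b2
  rw [v1, v4] at b3
  rw [v2, v3] at b4
  simp only [map_smul, map_neg, smul_apply, neg_apply,
    smul_eq_mul, dtheta_horiz_left, dtheta_horiz_right, dtheta_J_J] at b1 b2 b3 b4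
  rw [dtheta_swap, dtheta_J_symm] at b4
  have r1 : P.theta p (((P.holPart (frameField p i)).bracket
      (P.antiholPart (frameField p j))).re p) =
      -(1 / 2) * P.dtheta p (basisVec p i) (basisVec p j) := by
    simp only [ComplexField.bracket, map_sub]
    linarith
  have r2 : P.theta p (((P.holPart (frameField p i)).bracket
      (P.antiholPart (frameField p j))).im p) =
      -(1 / 2) * P.dtheta p (basisVec p i) (P.J p (basisVec p j)) := by
    simp only [ComplexField.bracket, map_add]
    linarith
  rw [r1, r2]
  push_cast
  ring

/-- On anti-CR functions the Kohn Laplacian is the first order operator `i n T`. -/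
theorem kohnLaplacian_of_isAntiCR {f : M → ℂ} (hs : ContMDiff (𝓡 (2 * n + 1)) 𝓘(ℝ, ℂ) ∞ f)
    (hf : P.IsAntiCR f) (p : M) :
    P.kohnLaplacian f p = Complex.I * n * dirDeriv f p (P.reeb p) := by
  have hh : ∀ i j, P.hessMixed f (P.holPart (frameField p i)) (P.antiholPart (frameField p j)) p =
      -(1 / 2) * (P.dtheta p (basisVec p i) (basisVec p j) +
        Complex.I * P.dtheta p (basisVec p i) (P.J p (basisVec p j))) *
          dirDeriv f p (P.reeb p) := by
    intro i j
    have hb := ComplexField.apply_bracket hs (P.smoothAt_holPart (smoothAt_frameField p i))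
      (P.smoothAt_antiholPart (smoothAt_frameField p j))
    rw [hf.holPart_apply] at hb
    have h0 : (P.antiholPart (frameField p j)).apply (fun _ : M => (0 : ℂ)) p = 0 := by
      simp [ComplexField.apply, dirDeriv_eq_mvfderiv, mvfderiv_const]
    rw [h0, sub_zero] at hb
    rw [← theta_bracket_holPart_antiholPart, hessMixed, ← hb, nablaMixed, hf.apply_eq]
    ring
  have e1 := congrArg (fun x : ℝ => (x : ℂ)) (P.sum_inv_metricMatrix_dtheta p)
  have e2 := congrArg (fun x : ℝ => (x : ℂ)) (P.sum_inv_metricMatrix_levi p)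
  push_cast at e1 e2
  have key : ∑ i, ∑ j, ((P.metricMatrix p)⁻¹ i j : ℂ) *
      P.hessMixed f (P.holPart (frameField p i)) (P.antiholPart (frameField p j)) p =
      -(1 / 2) * dirDeriv f p (P.reeb p) *
        (∑ i, ∑ j, ((P.metricMatrix p)⁻¹ i j : ℂ) *
          (P.dtheta p (basisVec p i) (basisVec p j) : ℂ)) +
      -(1 / 2) * Complex.I * dirDeriv f p (P.reeb p) *
        (∑ i, ∑ j, ((P.metricMatrix p)⁻¹ i j : ℂ) *
          (P.dtheta p (basisVec p i) (P.J p (basisVec p j)) : ℂ)) := by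
    simp only [Finset.mul_sum, ← Finset.sum_add_distrib, hh]
    exact Finset.sum_congr rfl fun i _ => Finset.sum_congr rfl fun j _ => by ring
  rw [kohnLaplacian, key, e1, e2]
  ring

end Pseudohermitian

/-! ### The geometry of spheres and of CR immersions into them -/

section SphereGeometry

variable {N : ℕ}

theorem kahlerForm_eq_inner (u v : EuclideanSpace ℂ (Fin N)) :
    kahlerForm u v = 2 * (inner ℂ u v).im := by
  rw [kahlerForm, Complex.I_mul_re, Complex.im_sum, PiLp.inner_apply, Complex.im_sum,
    Finset.mul_sum, ← Finset.sum_neg_distrib]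
  refine Finset.sum_congr rfl fun A _ => ?_
  simp only [RCLike.inner_apply, Complex.sub_im, Complex.mul_im, Complex.conj_re, Complex.conj_im]
  ring

theorem sphereTheta_eq_inner (z v : EuclideanSpace ℂ (Fin N)) :
    sphereTheta z v = (inner ℂ z v).im := by
  rw [sphereTheta, Complex.I_mul_re, Complex.im_sum, PiLp.inner_apply, Complex.im_sum,
    ← Finset.sum_neg_distrib]
  refine Finset.sum_congr rfl fun A _ => ?_
  simp only [RCLike.inner_apply, Complex.mul_im, Complex.conj_re, Complex.conj_im]
  ring

theorem sphereTangent_iff_inner (z v : EuclideanSpace ℂ (Fin N)) :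
    SphereTangent z v ↔ (inner ℂ z v).re = 0 := by
  simp only [SphereTangent, PiLp.inner_apply, RCLike.inner_apply, mul_comm]

/-- The Reeb vector of the sphere of radius `r` at `z` is `i z / r²`; here `μ = 1 / r²`. -/
theorem isSphereReeb_iff {z t : EuclideanSpace ℂ (Fin N)} {μ : ℝ} (h : μ * ‖z‖ ^ 2 = 1) :
    IsSphereReeb z t ↔ t = (Complex.I * μ) • z := by
  have hz : inner ℂ z z = ((‖z‖ ^ 2 : ℝ) : ℂ) := by
    rw [inner_self_eq_norm_sq_to_K]; push_cast; rfl
  have h1 : inner ℂ z ((Complex.I * μ) • z) = Complex.I := by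
    rw [inner_smul_right, hz, mul_assoc, ← Complex.ofReal_mul, h, Complex.ofReal_one, mul_one]
  have h2 : ∀ v, (inner ℂ ((Complex.I * μ) • z) v).im = -μ * (inner ℂ z v).re := fun v => by
    rw [inner_smul_left]
    simp
  simp only [IsSphereReeb, sphereTangent_iff_inner, sphereTheta_eq_inner, kahlerForm_eq_inner]
  constructor
  · rintro ⟨ht, hθ, hω⟩
    rw [← sub_eq_zero]
    set w := t - (Complex.I * μ) • z with hw
    have hzw : inner ℂ z w = 0 := by
      rw [hw, inner_sub_right, h1]
      apply Complex.ext <;> simp [ht, hθ]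
    -- `i w` is tangent to the sphere, and `ω(w, i w) = 2 ‖w‖²`.
    have hzi : inner ℂ z (Complex.I • w) = 0 := by rw [inner_smul_right, hzw, mul_zero]
    have h3 := hω (Complex.I • w) (by rw [hzi]; rfl)
    have h4 : (inner ℂ w (Complex.I • w)).im = 0 := by
      have e : inner ℂ w (Complex.I • w) =
          inner ℂ t (Complex.I • w) - inner ℂ ((Complex.I * μ) • z) (Complex.I • w) := by
        rw [← inner_sub_left]
      rw [e, Complex.sub_im, h2, hzi]
      simp only [Complex.zero_re]
      linarith
    rw [inner_smul_right, inner_self_eq_norm_sq_to_K] at h4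
    have h5 : ‖w‖ ^ 2 = 0 := by
      have : (Complex.I * ((‖w‖ : ℝ) : ℂ) ^ 2).im = ‖w‖ ^ 2 := by
        rw [← Complex.ofReal_pow, Complex.I_mul_im, Complex.ofReal_re]
      rw [← this]; exact h4
    simpa using h5
  · rintro rfl
    rw [h1]
    refine ⟨rfl, rfl, fun v hv => ?_⟩
    rw [h2, hv]
    ring

end SphereGeometry

theorem dirDeriv_inner {m : ℕ} {M : Type*} [TopologicalSpace M]
    [ChartedSpace (EuclideanSpace ℝ (Fin m)) M] {N : ℕ} {F G : M → EuclideanSpace ℂ (Fin N)} {p : M}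
    (hF : MDifferentiableAt (𝓡 m) 𝓘(ℝ, EuclideanSpace ℂ (Fin N)) F p)
    (hG : MDifferentiableAt (𝓡 m) 𝓘(ℝ, EuclideanSpace ℂ (Fin N)) G p)
    (v : TangentSpace (𝓡 m) p) :
    dirDeriv (fun q => (inner ℂ (F q) (G q) : ℂ)) p v =
      inner ℂ (F p) (dirDeriv G p v) + inner ℂ (dirDeriv F p v) (G p) := by
  let E := EuclideanSpace ℂ (Fin N)
  have h1 := (hasFDerivAt_fst (𝕜 := ℝ) (E := E) (F := E) (p := (F p, G p))).inner ℂ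
    (hasFDerivAt_snd (𝕜 := ℝ) (E := E) (F := E) (p := (F p, G p)))
  have h2 : HasMFDerivAt (𝓡 m) 𝓘(ℝ, E × E) (fun q => (F q, G q)) p
      ((mfderiv (𝓡 m) 𝓘(ℝ, E) F p).prod (mfderiv (𝓡 m) 𝓘(ℝ, E) G p)) :=
    ⟨hF.continuousAt.prodMk hG.continuousAt, hF.hasMFDerivAt.2.prodMk hG.hasMFDerivAt.2⟩
  have h := (HasMFDerivAt.comp p h1.hasMFDerivAt h2).mfderiv
  exact congrArg (fun T => T v) h

namespace Pseudohermitian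

variable {n : ℕ} {M : Type*} [TopologicalSpace M]
  [ChartedSpace (EuclideanSpace ℝ (Fin (2 * n + 1))) M]
  [IsManifold (𝓡 (2 * n + 1)) ∞ M] {P : Pseudohermitian n M} {N : ℕ}
  {Z : M → EuclideanSpace ℂ (Fin N)}

theorem IsCRImmersion.kohnLaplacian_conj (hZ : P.IsCRImmersion Z) (A : Fin N) (p : M) :
    P.kohnLaplacian (fun q => conj (Z q A : ℂ)) p =
      Complex.I * n * conj (dirDeriv Z p (P.reeb p) A : ℂ) := by
  let L : EuclideanSpace ℂ (Fin N) →L[ℝ] ℂ :=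
    (Complex.conjCLE : ℂ →L[ℝ] ℂ).comp
      ((EuclideanSpace.proj A : EuclideanSpace ℂ (Fin N) →L[ℂ] ℂ).restrictScalars ℝ)
  have hL : ∀ z, L z = conj (z A) := fun z => rfl
  have hs : ContMDiff (𝓡 (2 * n + 1)) 𝓘(ℝ, ℂ) ∞ (fun q => L (Z q)) :=
    L.contDiff.contMDiff.comp hZ.smooth
  have hd : ∀ q v, dirDeriv (fun q => L (Z q)) q v = conj (dirDeriv Z q v A) := fun q v =>
    dirDeriv_clm_comp L (hZ.smooth.mdifferentiable (by simp) q) v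
  have hf : P.IsAntiCR (fun q => L (Z q)) := by
    intro q v hv
    rw [hd, hd, hZ.cr q v hv]
    simp
  rw [← hd]
  exact P.kohnLaplacian_of_isAntiCR hs hf p

theorem IsCRImmersion.dirDeriv_reeb_ne_zero (hZ : P.IsCRImmersion Z) (p : M) :
    dirDeriv Z p (P.reeb p) ≠ 0 := by
  intro h
  have h0 : dirDeriv Z p 0 = 0 := map_zero (mvfderiv (𝓡 (2 * n + 1)) Z p)
  have hT := hZ.immersion p (h.trans h0.symm)
  have := P.theta_reeb p
  rw [hT, map_zero] at this
  exact zero_ne_one this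

/-- If `dZ(T)` is a complex multiple of the position vector `Z`, then `dθ(T, ·) = 0` makes `Z`
Hermitian orthogonal to `dZ(H)`. -/
theorem IsSemiIsometric.inner_dirDeriv_eq_zero (hZ : P.IsSemiIsometric Z) {p : M} {c : ℂ}
    (hT : dirDeriv Z p (P.reeb p) = c • Z p) {v : TangentSpace (𝓡 (2 * n + 1)) p}
    (hv : P.theta p v = 0) : inner ℂ (Z p) (dirDeriv Z p v) = (0 : ℂ) := by
  have hc : c ≠ 0 := by
    rintro rfl
    exact hZ.dirDeriv_reeb_ne_zero p (by rw [hT, zero_smul])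
  have h : ∀ w : TangentSpace (𝓡 (2 * n + 1)) p,
      (conj c * inner ℂ (Z p) (dirDeriv Z p w)).im = 0 := fun w => by
    have h1 := hZ.pullback p (P.reeb p) w
    rw [P.dtheta_reeb, kahlerForm_eq_inner, hT, inner_smul_left] at h1
    linarith
  have h1 := h v
  have h2 := h (P.J p v)
  rw [hZ.cr p v hv, inner_smul_right, mul_left_comm] at h2
  have h3 : conj c * inner ℂ (Z p) (dirDeriv Z p v) = 0 :=
    Complex.ext (by simpa using h2) h1
  exact (mul_eq_zero.1 h3).resolve_left (by simpa using hc)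

/-- As the Levi form has trace `2n`, it does not vanish when `n ≥ 1`. -/
theorem exists_dtheta_J_ne_zero (P : Pseudohermitian n M) (hn : 1 ≤ n) (p : M) :
    ∃ u v : TangentSpace (𝓡 (2 * n + 1)) p, P.dtheta p u (P.J p v) ≠ 0 := by
  by_contra! h
  have hs := P.sum_inv_metricMatrix_levi p
  simp only [h, mul_zero, Finset.sum_const_zero] at hs
  have : (1 : ℝ) ≤ n := by exact_mod_cast hn
  linarith

/-- If `Z` is Hermitian orthogonal to `dZ(H)`, then `Z^* (i ∂̄‖Z‖²) = c θ` for a function `c`, and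
comparing the exterior derivatives on `H` gives `c = 1`. -/
theorem IsSemiIsometric.sphereTheta_reeb_eq_one (hZ : P.IsSemiIsometric Z) (hn : 1 ≤ n)
    (horth : ∀ p v, P.theta p v = 0 → inner ℂ (Z p) (dirDeriv Z p v) = (0 : ℂ)) (p : M) :
    sphereTheta (Z p) (dirDeriv Z p (P.reeb p)) = 1 := by
  obtain ⟨u, v, huv⟩ := P.exists_dtheta_J_ne_zero hn p
  let X : ∀ q : M, TangentSpace (𝓡 (2 * n + 1)) q := fun q => P.horiz q (extendField u q)
  let Y : ∀ q : M, TangentSpace (𝓡 (2 * n + 1)) q := fun q => P.J q (extendField v q)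
  have hX : SmoothFieldAt X p := smoothFieldAt_horiz (smoothFieldAt_extendField u)
  have hY : SmoothFieldAt Y p := smoothFieldAt_J (smoothFieldAt_extendField v)
  have hX0 : ∀ q, P.theta q (X q) = 0 := fun q => P.theta_horiz _ _
  have hY0 : ∀ q, P.theta q (Y q) = 0 := fun q => P.theta_J _ _
  have hbr := P.smoothOneForm_theta.extDeriv_eq_neg_bracket hX hY hX0 hY0
  change P.dtheta p (X p) (Y p) = _ at hbr
  have hne : P.dtheta p (X p) (Y p) ≠ 0 := by
    change P.dtheta p (P.horiz p (extendField u p)) (P.J p (extendField v p)) ≠ 0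
    rwa [dtheta_horiz_left, extendField_self, extendField_self]
  have hω : P.dtheta p (X p) (Y p) = 2 * (inner ℂ (dirDeriv Z p (X p)) (dirDeriv Z p (Y p))).im := by
    rw [dtheta_apply, hZ.pullback, kahlerForm_eq_inner]
  have hd : ∀ {W : ∀ q : M, TangentSpace (𝓡 (2 * n + 1)) q}, SmoothFieldAt W p →
      (∀ q, P.theta q (W q) = 0) → ∀ w : TangentSpace (𝓡 (2 * n + 1)) p,
        inner ℂ (Z p) (dirDeriv (fun q => dirDeriv Z q (W q)) p w) +
        inner ℂ (dirDeriv Z p w) (dirDeriv Z p (W p)) = (0 : ℂ) := by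
    intro W hW hW0 w
    rw [← dirDeriv_inner (hZ.smooth.mdifferentiable (by simp) p)
      (mdifferentiableAt_dirDeriv_and_eq hZ.smooth hW.mdifferentiableAt).1]
    simp only [fun q => horth q _ (hW0 q)]
    simp [dirDeriv_eq_mvfderiv, mvfderiv_const]
  -- Differentiate `⟨Z, dZ(Y)⟩ = 0` along `X` and `⟨Z, dZ(X)⟩ = 0` along `Y`; the difference of the
  -- two equations contains `⟨Z, dZ([X, Y])⟩ = θ([X, Y]) ⟨Z, dZ(T)⟩`, with imaginary part
  -- `c θ([X, Y]) = -c dθ(X, Y)`.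
  have h1 := hd hY hY0 (X p)
  have h2 := hd hX hX0 (Y p)
  have hsplit : ∀ w : TangentSpace (𝓡 (2 * n + 1)) p, inner ℂ (Z p) (dirDeriv Z p w) =
      (P.theta p w : ℂ) * inner ℂ (Z p) (dirDeriv Z p (P.reeb p)) := fun w => by
    have h := horth p _ (P.theta_horiz p w)
    rw [horiz, dirDeriv_sub, dirDeriv_smul, inner_sub_right, inner_smul_right_eq_smul,
      Complex.real_smul] at h
    exact sub_eq_zero.1 h
  have h3 := hsplit (mlieBracket (𝓡 (2 * n + 1)) X Y p)
  rw [dirDeriv_mlieBracket hZ.smooth hX.mdifferentiableAt hY.mdifferentiableAt,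
    inner_sub_right] at h3
  have h4 : (inner ℂ (dirDeriv Z p (Y p)) (dirDeriv Z p (X p))).im =
      -(inner ℂ (dirDeriv Z p (X p)) (dirDeriv Z p (Y p))).im := by
    rw [← inner_conj_symm, Complex.conj_im]
  have i1 := congrArg Complex.im h1
  have i2 := congrArg Complex.im h2
  have i3 := congrArg Complex.im h3
  simp only [Complex.add_im, Complex.sub_im, Complex.zero_im, Complex.im_ofReal_mul] at i1 i2 i3
  rw [sphereTheta_eq_inner]
  have h5 : P.dtheta p (X p) (Y p) *
      ((inner ℂ (Z p) (dirDeriv Z p (P.reeb p))).im - 1) = 0 := by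
    rw [mul_sub, mul_one]
    nth_rw 1 [hbr]
    rw [hω]
    linarith
  linarith [(mul_eq_zero.1 h5).resolve_left hne]

/-- The Reeb derivative of an eigenmap `Z̄` of the Kohn Laplacian. -/
theorem IsCRImmersion.dirDeriv_reeb_of_eigen (hZ : P.IsCRImmersion Z) (hn : 1 ≤ n) {lam : ℂ} {p : M}
    (h : ∀ A, P.kohnLaplacian (fun q => conj (Z q A : ℂ)) p = lam * conj (Z p A : ℂ)) :
    dirDeriv Z p (P.reeb p) = (Complex.I * (conj lam / n)) • Z p := by
  have hn0 : (n : ℂ) ≠ 0 := by exact_mod_cast (by omega : n ≠ 0)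
  ext A
  have hA := congrArg conj (h A)
  rw [hZ.kohnLaplacian_conj] at hA
  simp only [map_mul, Complex.conj_conj, Complex.conj_I, map_natCast] at hA
  rw [PiLp.smul_apply, smul_eq_mul]
  field_simp
  linear_combination Complex.I * hA + n * (dirDeriv Z p (P.reeb p)).ofLp A * Complex.I_mul_I

/-- A semi-isometric CR immersion whose conjugate is an eigenmap of the Kohn Laplacian is a
pseudohermitian immersion into a sphere of radius determined by the eigenvalue. -/
theorem IsSemiIsometric.takahashi [Nonempty M] (hZ : P.IsSemiIsometric Z) (hn : 1 ≤ n) {lam : ℂ}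
    (h : ∀ A p, P.kohnLaplacian (fun q => conj (Z q A : ℂ)) p = lam * conj (Z p A : ℂ)) :
    ∃ l : ℝ, lam = l ∧ 0 < l ∧
      (∀ p, Z p ∈ Metric.sphere (0 : EuclideanSpace ℂ (Fin N)) (√(n / l))) ∧
      P.IsPseudohermitianImmersionIntoSphere (√(n / l)) Z := by
  have hn0 : (0 : ℝ) < n := by exact_mod_cast hn
  have hT := fun p => hZ.dirDeriv_reeb_of_eigen hn (p := p) (fun A => h A p)
  have horth : ∀ p v, P.theta p v = 0 → inner ℂ (Z p) (dirDeriv Z p v) = (0 : ℂ) :=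
    fun p v hv => hZ.inner_dirDeriv_eq_zero (hT p) hv
  have hone := hZ.sphereTheta_reeb_eq_one hn horth
  have hself : ∀ z : EuclideanSpace ℂ (Fin N), inner ℂ z z = ((‖z‖ ^ 2 : ℝ) : ℂ) := fun z => by
    rw [inner_self_eq_norm_sq_to_K]; push_cast; rfl
  have hmu : ∀ p, inner ℂ (Z p) (dirDeriv Z p (P.reeb p)) =
      Complex.I * (conj lam / n) * ((‖Z p‖ ^ 2 : ℝ) : ℂ) := fun p => by
    rw [hT, inner_smul_right, hself]
  have hre : ∀ p, lam.re / n * ‖Z p‖ ^ 2 = 1 := fun p => by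
    rw [← hone p, sphereTheta_eq_inner, hmu, Complex.im_mul_ofReal, Complex.I_mul_im,
      Complex.div_natCast_re, Complex.conj_re]
  obtain ⟨p₀⟩ := ‹Nonempty M›
  have hpos : 0 < lam.re := by
    have h1 : 0 < lam.re / n := by
      by_contra! hle
      nlinarith [hre p₀, sq_nonneg ‖Z p₀‖]
    simpa [div_pos_iff_of_pos_right hn0] using h1
  -- As `‖Z‖²` is constant, `0 = T ‖Z‖² = 2 Re ⟨Z, dZ(T)⟩`, and this is a multiple of `Im λ`.
  have him : lam.im = 0 := by
    have hc : (fun q => (inner ℂ (Z q) (Z q) : ℂ)) = fun _ => ((n / lam.re : ℝ) : ℂ) := by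
      funext q
      rw [hself, Complex.ofReal_inj]
      have := hre q
      field_simp at this ⊢
      linarith
    have hd := hZ.smooth.mdifferentiable (by simp) p₀
    have h1 := dirDeriv_inner hd hd (P.reeb p₀)
    rw [hc, dirDeriv_eq_mvfderiv, mvfderiv_const, zero_apply, ← inner_conj_symm (dirDeriv Z p₀ _),
      hmu, Complex.add_conj] at h1
    have h2 := congrArg Complex.re h1
    rw [Complex.ofReal_re, Complex.re_mul_ofReal, Complex.I_mul_re, Complex.div_natCast_im,
      Complex.conj_im, Complex.zero_re] at h2
    have h3 : ‖Z p₀‖ ^ 2 ≠ 0 := fun h0 => by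
      have := hre p₀
      rw [h0, mul_zero] at this
      exact zero_ne_one this
    have h4 : lam.im / n * ‖Z p₀‖ ^ 2 = 0 := by
      rw [neg_div, neg_neg] at h2
      linarith
    have h5 := (mul_eq_zero.1 h4).resolve_right h3
    exact (div_eq_zero_iff.1 h5).resolve_right hn0.ne'
  have hlam : lam = (lam.re : ℂ) := Complex.ext rfl (by simpa using him)
  have hsphere : ∀ p, Z p ∈ Metric.sphere (0 : EuclideanSpace ℂ (Fin N)) (√(n / lam.re)) := by
    intro p
    rw [mem_sphere_zero_iff_norm, eq_comm, Real.sqrt_eq_iff_mul_self_eq (by positivity)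
      (norm_nonneg _)]
    have := hre p
    field_simp at this ⊢
    linarith
  have hcoef : Complex.I * (conj lam / n) = Complex.I * ((lam.re / n : ℝ) : ℂ) := by
    rw [hlam, Complex.conj_ofReal]
    push_cast
    simp
  refine ⟨lam.re, hlam, hpos, hsphere, hZ.toIsCRImmersion, hsphere, fun p v hv => ?_,
    fun p v => ?_, fun p => ?_⟩
  · rw [SphereHolTangent, sphereTangent_iff_inner, sphereTangent_iff_inner, inner_smul_right,
      horth p v hv]
    simp
  · have h1 := horth p _ (P.theta_horiz p v)
    rw [horiz, dirDeriv_sub, dirDeriv_smul, inner_sub_right, inner_smul_right_eq_smul,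
      Complex.real_smul] at h1
    have h2 := hone p
    rw [sphereTheta_eq_inner] at h2
    rw [sphereTheta_eq_inner, sub_eq_zero.1 h1, Complex.im_ofReal_mul, h2, mul_one]
  · rw [isSphereReeb_iff (hre p), ← hcoef, hT]

theorem IsPseudohermitianImmersionIntoSphere.kohnLaplacian_conj {r : ℝ} (hr : 0 < r)
    (hF : P.IsPseudohermitianImmersionIntoSphere r Z) (A : Fin N) (p : M) :
    P.kohnLaplacian (fun q => conj (Z q A : ℂ)) p =
      ((n / r ^ 2 : ℝ) : ℂ) * conj (Z p A : ℂ) := by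
  have hnorm : ‖Z p‖ = r := mem_sphere_zero_iff_norm.1 (hF.mem_sphere p)
  have h1 : (1 / r ^ 2) * ‖Z p‖ ^ 2 = 1 := by
    rw [hnorm]
    field_simp
  rw [hF.toIsCRImmersion.kohnLaplacian_conj, (isSphereReeb_iff h1).1 (hF.map_reeb p),
    PiLp.smul_apply, smul_eq_mul]
  simp only [map_mul, Complex.conj_I, Complex.conj_ofReal]
  push_cast
  linear_combination (-(n : ℂ) / r ^ 2 * conj (Z p A : ℂ)) * Complex.I_mul_I

end Pseudohermitian

/-! ### The Takahashi-type theorem -/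

theorem theorem4p3 {n : ℕ} (hn : 1 ≤ n) {M : Type*} [TopologicalSpace M]
    [ChartedSpace (EuclideanSpace ℝ (Fin (2 * n + 1))) M]
    [IsManifold (𝓡 (2 * n + 1)) ∞ M] [Nonempty M] (P : Pseudohermitian n M) (N : ℕ) :
    (∀ (Z : M → EuclideanSpace ℂ (Fin N)) (lam : ℂ), P.IsSemiIsometric Z →
      (∀ (A : Fin N) (p : M),
        P.kohnLaplacian (fun q => conj (Z q A : ℂ)) p = lam * conj (Z p A : ℂ)) →
      ∃ l : ℝ, lam = l ∧ 0 < l ∧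
        (∀ p, Z p ∈ Metric.sphere (0 : EuclideanSpace ℂ (Fin N)) (√(n / l))) ∧
        P.IsPseudohermitianImmersionIntoSphere (√(n / l)) Z) ∧
    (∀ (F : M → EuclideanSpace ℂ (Fin N)) (r : ℝ), 0 < r →
      P.IsPseudohermitianImmersionIntoSphere r F →
      ∀ (A : Fin N) (p : M),
        P.kohnLaplacian (fun q => conj (F q A : ℂ)) p = ((n / r ^ 2 : ℝ) : ℂ) * conj (F p A : ℂ)) :=
  ⟨fun _ _ hZ h => hZ.takahashi hn h, fun _ _ hr hF A p => hF.kohnLaplacian_conj hr A p⟩
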